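/- Let $\Omega\subset\mathbb{R}^d$ be a bounded open set and let $\mathrm{H}^1_0(\Omega)$ be the closure of $C_c^\infty(\Omega)$ in $\mathrm{H}^1(\Omega)$. Let $C_P>0$ be a constant with $\|v\|_{\mathrm{L}^2(\Omega)}^2\le C_P\|\nabla v\|_{\mathrm{L}^2(\Omega)}^2$ for all $v\in\mathrm{H}^1_0(\Omega)$. Let $f:\Omega\times\mathbb{R}\to\mathbb{R}$ and $\rho>0$ be such that (i) $f(\cdot,s)\in\mathrm{L}^2(\Omega)$ for all $s\in\mathbb{R}$; (ii) $f$ is differentiable in the second variable; (iii) the set $\Lambda_f(\rho):=\{\lambda>0:\ \sigma_f(\lambda)<\rho+\tfrac1\lambda\}$ is non-empty, where $\sigma_f(\lambda):=\operatorname{ess\,sup}_{x\in\Omega}\sup_{u\in\mathbb{R}}\left|\frac{\partial f}{\partial u}(x,u)+\frac1\lambda\right|\in[0,\infty]$. Set $\mu_f:=2(\sup\Lambda_f(\rho))^{-1}$ if $\sup\Lambda_f(\rho)<\infty$ and $\mu_f:=0$ otherwise, and let $$\kappa_f:=\tfrac12\max\{0,\mu_f+\rho-C_P^{-1}\},\qquad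 \eta>\kappa_f,\qquad \gamma_f:=\eta\min\left\{\frac{\eta-\kappa_f}{\eta+C_P^{-1}},\frac12\right\}.$$ Let $F:\Omega\times\mathbb{R}\to\mathbb{R}$ be a potential of $f$, that is, for almost every $x\in\Omega$, $\partial_zF(x,z)=f(x,z)$ for all $z\in\mathbb{R}$, with $F(\cdot,0)\in\mathrm{L}^1(\Omega)$. Consider the energy of the problem $-\Delta u=f(x,u)$ in $\Omega$, $u=0$ on $\partial\Omega$, $$E(v):=\frac12\int_\Omega|\nabla v|^2\,dx-\int_\Omega F(x,v(x))\,dx,\qquad v\in\mathrm{H}^1_0(\Omega),$$ and the operator $A_\eta=-\Delta+\eta$ given by $\langle A_\eta u,v\rangle=\int_\Omega\nabla u\cdot\nabla v\,dx+\eta\int_\Omega uv\,dx$ for $u,v\in\mathrm{H}^1_0(\Omega)$. Then $E$ has a Gâteaux derivative $E'(w)$ (a bounded linear functional) at every $w\in\mathrm{H}^1_0(\Omega)$, and there is an operator $T:\mathrm{H}^1_0(\Omega)\to\mathrm{H}^1_0(\Omega)$ with $$\langle A_\eta(T(w)-w),v\rangle=-\langle E'(w),v\rangle\qquad\forall v,w\in\mathrm{H}^1_0(\Omega).$$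 Moreover, let $u^0\in\mathrm{H}^1_0(\Omega)$, and let $E'$ and $T$ satisfy these relations for all $w$ in the level set $\{w\in\mathrm{H}^1_0(\Omega):E(w)\le E(u^0)\}$ (and all $v\in\mathrm{H}^1_0(\Omega)$). Then property (T) holds with the constant $\gamma:=\gamma_f/\eta$: we have $\gamma>0$ and, for all $w$ in this level set, $$E(w)-E(T(w))\ge-\gamma\langle E'(w),T(w)-w\rangle\quad\text{and}\quad E(w)-E(T(w))\ge\gamma\langle A_\eta(T(w)-w),T(w)-w\rangle.$$ -/

import Mathlib

open MeasureTheory Topology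
open scoped ContDiff ENNReal Gradient

noncomputable section

namespace Semilinear

/-! ### Abstract energy framework -/

section Abstract

variable {X : Type*} [NormedAddCommGroup X] [NormedSpace ℝ X]

/-- The bounded linear functional `L` is the Gâteaux derivative of `E` at `u`. -/
def HasGateauxDerivAt (E : X → ℝ) (L : X →L[ℝ] ℝ) (u : X) : Prop :=
  ∀ v : X, Filter.Tendsto (fun t : ℝ => (E (u + t • v) - E u) / t) (𝓝[≠] 0) (𝓝 (L v))

/-- The energy level set `M(z) = {v : E(v) ≤ E(z)}`. -/
def levelSet (E : X → ℝ) (z : X) : Set X := {v | E v ≤ E z}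

/-- `T` satisfies, at the point `w`, the equation `⟨A[w](T(w) - w), v⟩ = -⟨E'(w), v⟩` for all `v`
that defines the update operator. -/
def IsUpdateAt (E' : X → (X →L[ℝ] ℝ)) (A : X → (X →L[ℝ] (X →L[ℝ] ℝ))) (T : X → X) (w : X) :
    Prop :=
  ∀ v : X, A w (T w - w) v = -(E' w v)

/-- Property (T) on the level set `M(u₀)` with constant `γ > 0`, in both of its forms. -/
def PropertyT (E : X → ℝ) (E' : X → (X →L[ℝ] ℝ)) (A : X → (X →L[ℝ] (X →L[ℝ] ℝ)))
    (T : X → X) (u₀ : X) (γ : ℝ) : Prop :=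
  0 < γ ∧ ∀ w ∈ levelSet E u₀,
    E w - E (T w) ≥ -γ * E' w (T w - w) ∧
    E w - E (T w) ≥ γ * A w (T w - w) (T w - w)

end Abstract

/-! ### The Sobolev space `H¹₀(Ω)` -/

/-- The Hilbert space `L²(Ω) × L²(Ω; ℝᵈ)` with `‖(v, g)‖² = ‖v‖² + ‖g‖²`. -/
abbrev L2Pair {d : ℕ} (Ω : Set (EuclideanSpace ℝ (Fin d))) : Type :=
  WithLp 2 (Lp ℝ 2 (volume.restrict Ω) × Lp (EuclideanSpace ℝ (Fin d)) 2 (volume.restrict Ω))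

/-- The pairs `(φ, ∇φ)` with `φ ∈ C_c^∞(Ω)`. -/
def testPairs {d : ℕ} (Ω : Set (EuclideanSpace ℝ (Fin d))) : Submodule ℝ (L2Pair Ω) where
  carrier := {p | ∃ φ : EuclideanSpace ℝ (Fin d) → ℝ,
    ContDiff ℝ ∞ φ ∧ HasCompactSupport φ ∧ tsupport φ ⊆ Ω ∧
    p.fst =ᵐ[volume.restrict Ω] φ ∧ p.snd =ᵐ[volume.restrict Ω] ∇ φ}
  zero_mem' := by
    refine ⟨0, contDiff_const, HasCompactSupport.zero, by simp [tsupport], ?_, ?_⟩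
    · exact Lp.coeFn_zero _ _ _
    · refine (Lp.coeFn_zero _ _ _).trans (Filter.Eventually.of_forall fun x => ?_)
      exact (gradient_fun_const x (0 : ℝ)).symm
  add_mem' := by
    rintro p q ⟨φ, hφ, hφc, hφs, h1, h2⟩ ⟨ψ, hψ, hψc, hψs, h3, h4⟩
    refine ⟨φ + ψ, hφ.add hψ, hφc.add hψc,
      (tsupport_add φ ψ).trans (Set.union_subset hφs hψs), ?_, ?_⟩
    · exact (Lp.coeFn_add p.fst q.fst).trans (h1.add h3)
    · refine (Lp.coeFn_add p.snd q.snd).trans ((h2.add h4).trans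
        (Filter.Eventually.of_forall fun x => ?_))
      have hd1 := (hφ.differentiable (by simp)) x
      have hd2 := (hψ.differentiable (by simp)) x
      simp [gradient, fderiv_add hd1 hd2]
  smul_mem' := by
    rintro c p ⟨φ, hφ, hφc, hφs, h1, h2⟩
    refine ⟨c • φ, contDiff_const.smul hφ, hφc.smul_left,
      (closure_mono (Function.support_const_smul_subset c φ)).trans hφs, ?_, ?_⟩
    · exact (Lp.coeFn_smul c p.fst).trans (h1.const_smul c)
    · refine (Lp.coeFn_smul c p.snd).trans ((h2.const_smul c).trans
        (Filter.Eventually.of_forall fun x => ?_))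
      have hd1 := (hφ.differentiable (by simp)) x
      simp [gradient, fderiv_const_smul hd1]

/-- `H¹₀(Ω)`: the closure of `C_c^∞(Ω)` with respect to the `H¹`-norm
`(‖v‖² + ‖∇v‖²)^{1/2}`, each function being carried together with its weak gradient.
On a bounded set this norm is equivalent to `‖∇v‖`. -/
abbrev H10 {d : ℕ} (Ω : Set (EuclideanSpace ℝ (Fin d))) : Type :=
  (testPairs Ω).topologicalClosure

section Sobolev

variable {d : ℕ} {Ω : Set (EuclideanSpace ℝ (Fin d))}

/-- The embedding `H¹₀(Ω) → L²(Ω)`. -/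
def H10.val : H10 Ω →L[ℝ] Lp ℝ 2 (volume.restrict Ω) :=
  (WithLp.fstL 2 ℝ _ _).comp (testPairs Ω).topologicalClosure.subtypeL

/-- The weak gradient `H¹₀(Ω) → L²(Ω; ℝᵈ)`. -/
def H10.grad : H10 Ω →L[ℝ] Lp (EuclideanSpace ℝ (Fin d)) 2 (volume.restrict Ω) :=
  (WithLp.sndL 2 ℝ _ _).comp (testPairs Ω).topologicalClosure.subtypeL

/-- `H10.grad v` is indeed the weak gradient of `H10.val v`. -/
theorem H10.integral_val_mul_fderiv (v : H10 Ω)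
    (φ : EuclideanSpace ℝ (Fin d) → ℝ) (hφ : ContDiff ℝ ∞ φ) (hφc : HasCompactSupport φ)
    (hφs : tsupport φ ⊆ Ω) (i : Fin d) :
    ∫ x in Ω, H10.val v x * fderiv ℝ φ x (EuclideanSpace.single i 1) =
      -∫ x in Ω, H10.grad v x i * φ x := by
  set e : EuclideanSpace ℝ (Fin d) := EuclideanSpace.single i 1
  have hφ' : Continuous fun x => fderiv ℝ φ x e :=
    (hφ.continuous_fderiv (by simp)).clm_apply continuous_const
  have hφ'c : HasCompactSupport fun x => fderiv ℝ φ x e := hφc.fderiv_apply ℝ e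
  have m1 : MemLp (fun x => fderiv ℝ φ x e) 2 (volume.restrict Ω) :=
    (hφ'.memLp_of_hasCompactSupport hφ'c)
  have m2 : MemLp (fun x => φ x • e) 2 (volume.restrict Ω) :=
    (hφ.continuous.smul continuous_const).memLp_of_hasCompactSupport hφc.smul_right
  have key : ∀ p : L2Pair Ω, p ∈ (testPairs Ω).topologicalClosure →
      inner ℝ p.fst (m1.toLp _) + inner ℝ p.snd (m2.toLp _) = 0 := by
    intro p hp
    have hcl : IsClosed {p : L2Pair Ω |
        inner ℝ p.fst (m1.toLp _) + inner ℝ p.snd (m2.toLp _) = 0} := by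
      refine isClosed_eq ?_ continuous_const
      have c1 : Continuous fun p : L2Pair Ω => p.fst := (WithLp.fstL 2 ℝ _ _).continuous
      have c2 : Continuous fun p : L2Pair Ω => p.snd := (WithLp.sndL 2 ℝ _ _).continuous
      exact (c1.inner continuous_const).add (c2.inner continuous_const)
    refine closure_minimal ?_ hcl hp
    rintro p ⟨ψ, hψ, hψc, hψs, h1, h2⟩
    have hψ' : Continuous fun x => fderiv ℝ ψ x e :=
      (hψ.continuous_fderiv (by simp)).clm_apply continuous_const
    have e1 : inner ℝ p.fst (m1.toLp _) = ∫ x, ψ x * fderiv ℝ φ x e := by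
      rw [L2.inner_def, ← setIntegral_eq_integral_of_forall_compl_eq_zero (s := Ω)
        (f := fun x => ψ x * fderiv ℝ φ x e)]
      · refine integral_congr_ae ?_
        filter_upwards [h1, m1.coeFn_toLp] with x hx hx'
        simp [hx, hx', mul_comm]
      · intro x hx
        rw [image_eq_zero_of_notMem_tsupport fun h => hx (hψs h), zero_mul]
    have e2 : inner ℝ p.snd (m2.toLp _) = ∫ x, fderiv ℝ ψ x e * φ x := by
      rw [L2.inner_def, ← setIntegral_eq_integral_of_forall_compl_eq_zero (s := Ω)
        (f := fun x => fderiv ℝ ψ x e * φ x)]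
      · refine integral_congr_ae ?_
        filter_upwards [h2, m2.coeFn_toLp] with x hx hx'
        rw [hx, hx', inner_smul_right, gradient, InnerProductSpace.toDual_symm_apply, mul_comm]
      · intro x hx
        rw [image_eq_zero_of_notMem_tsupport fun h => hx (hφs h), mul_zero]
    have := integral_mul_fderiv_eq_neg_fderiv_mul_of_integrable (μ := volume) (v := e)
      (f := ψ) (g := φ)
      ((hψ'.mul hφ.continuous).integrable_of_hasCompactSupport hφc.mul_left)
      ((hψ.continuous.mul hφ').integrable_of_hasCompactSupport hφ'c.mul_left)
      ((hψ.continuous.mul hφ.continuous).integrable_of_hasCompactSupport hφc.mul_left)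
      (fun x _ => hψ.differentiable (by simp) x) (fun x _ => hφ.differentiable (by simp) x)
    change _ + _ = _
    rw [e1, e2, this, neg_add_cancel]
  have h := key v v.2
  rw [L2.inner_def, L2.inner_def] at h
  have a1 : ∫ x in Ω, H10.val v x * fderiv ℝ φ x e =
      ∫ x in Ω, inner ℝ ((v : L2Pair Ω).fst x) (m1.toLp _ x) := by
    refine integral_congr_ae ?_
    filter_upwards [m1.coeFn_toLp] with x hx'
    rw [hx']
    exact mul_comm _ _
  have a2 : ∫ x in Ω, H10.grad v x i * φ x =
      ∫ x in Ω, inner ℝ ((v : L2Pair Ω).snd x) (m2.toLp _ x) := by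
    refine integral_congr_ae ?_
    filter_upwards [m2.coeFn_toLp] with x hx'
    rw [hx', inner_smul_right]
    simp [e, EuclideanSpace.inner_single_right, mul_comm]
    left; rfl
  rw [a1, a2]
  linarith

end Sobolev

/-! ### The semilinear problem -/

section Problem

variable {d : ℕ} (Ω : Set (EuclideanSpace ℝ (Fin d)))

/-- The energy `E(v) = ½ ∫_Ω |∇v|² dx - ∫_Ω F(x, v(x)) dx` on `H¹₀(Ω)`. -/
def energy (F : EuclideanSpace ℝ (Fin d) → ℝ → ℝ) (v : H10 Ω) : ℝ :=
  (1 / 2) * (∫ x in Ω, ‖H10.grad v x‖ ^ 2) - (∫ x in Ω, F x (H10.val v x))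

/-- The operator `A_η = -Δ + η` from `H¹₀(Ω)` to its dual, in weak form; see
`linearization_apply`. -/
def linearization (η : ℝ) : H10 Ω →L[ℝ] (H10 Ω →L[ℝ] ℝ) :=
  (innerSL ℝ (E := Lp (EuclideanSpace ℝ (Fin d)) 2 (volume.restrict Ω))).bilinearComp
      (σ₁₃ := RingHom.id ℝ) (H10.grad (Ω := Ω)) (H10.grad (Ω := Ω)) +
    η • (innerSL ℝ (E := Lp ℝ 2 (volume.restrict Ω))).bilinearComp
      (σ₁₃ := RingHom.id ℝ) (H10.val (Ω := Ω)) (H10.val (Ω := Ω))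

theorem linearization_apply (η : ℝ) (u v : H10 Ω) :
    linearization Ω η u v =
      (∫ x in Ω, inner ℝ (H10.grad u x) (H10.grad v x)) +
        η * ∫ x in Ω, H10.val u x * H10.val v x := by
  change inner ℝ (H10.grad u) (H10.grad v) + η * inner ℝ (H10.val u) (H10.val v) = _
  rw [L2.inner_def, L2.inner_def]
  congr 2
  exact integral_congr_ae (Filter.Eventually.of_forall fun x => mul_comm _ _)

variable (f : EuclideanSpace ℝ (Fin d) → ℝ → ℝ)

/-- `σ_f(t) = ess sup_{x ∈ Ω} sup_{u ∈ ℝ} |∂f/∂u(x,u) + 1/t|`, with values in `[0, ∞]`. -/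
def sigma (t : ℝ) : ℝ≥0∞ :=
  essSup (fun x => ⨆ u : ℝ, ENNReal.ofReal |deriv (f x) u + 1 / t|) (volume.restrict Ω)

/-- `Λ_f(ρ) = {t > 0 : σ_f(t) < ρ + 1/t}`. -/
def Lambda (ρ : ℝ) : Set ℝ :=
  {t | 0 < t ∧ sigma Ω f t < ENNReal.ofReal (ρ + 1 / t)}

open Classical in
/-- `μ_f = 2 (sup Λ_f(ρ))⁻¹` if `sup Λ_f(ρ) < ∞`, and `0` otherwise. -/
def mu (ρ : ℝ) : ℝ :=
  if BddAbove (Lambda Ω f ρ) then 2 * (sSup (Lambda Ω f ρ))⁻¹ else 0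

/-- `κ_f = ½ max{0, μ_f + ρ - C_P⁻¹}`. -/
def kappa (ρ CP : ℝ) : ℝ := (1 / 2) * max 0 (mu Ω f ρ + ρ - CP⁻¹)

/-- `γ_f = η min{(η - κ_f)/(η + C_P⁻¹), ½}`. -/
def gammaf (ρ CP η : ℝ) : ℝ :=
  η * min ((η - kappa Ω f ρ CP) / (η + CP⁻¹)) (1 / 2)

end Problem

end Semilinear

end

/-! Put `δ = T w - w`, `a = ‖∇δ‖²`, `b = ‖δ‖²`. The Dirichlet part of `E` is quadratic, so expanding
`E` at `w` leaves only the Taylor remainder of `F`. For `t ∈ Λ_f(ρ)` one has `∂f/∂u ≥ -(ρ + 2/t)`,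
which bounds that remainder below by `-(ρ + 2/t) b / 2`. The update equation tested with `δ` gives
`-⟨E'(w), δ⟩ = a + η b`, hence `E(w) - E(T w) ≥ a/2 + (η - (ρ + 2/t)/2) b` (`energy_add_sub_le`).
Letting `2/t` approach its infimum `μ_f`, Poincaré's inequality shows that the right side dominates
`γ (a + η b)` (`gammaf_div_mul_le`).

Existence of `E'` rests on the two-sided bound on `∂f/∂u`, which makes `f` Lipschitz and the
remainder of `E` quadratic; existence of `T` is Lax-Milgram. An arbitrary admissible `E'` is handled
by uniqueness of Gâteaux derivatives. -/

namespace Semilinear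

/-! ### One-variable Taylor estimates -/

section Scalar

/-- Taylor's inequality when the derivative `g` has slopes bounded below by `-m`. -/
theorem neg_mul_sq_le_taylor_remainder {G g : ℝ → ℝ} {m : ℝ}
    (hG : ∀ z, HasDerivAt G (g z) z) (hg : Differentiable ℝ g) (hm : ∀ z, -m ≤ deriv g z)
    (a h : ℝ) : -(m / 2 * h ^ 2) ≤ G (a + h) - G a - g a * h := by
  -- The monotone function `g z + m z` is the derivative of `G z + m/2 z²`, which is therefore
  -- convex; `key` is its tangent inequality at `a`.
  have hmono : Monotone fun z => g z + m * z := by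
    have hd : ∀ z, HasDerivAt (fun z => g z + m * z) (deriv g z + m) z := fun z =>
      ((hg z).hasDerivAt.add ((hasDerivAt_id z).const_mul m)).congr_deriv (by simp)
    refine monotone_of_deriv_nonneg (fun z => (hd z).differentiableAt) fun z => ?_
    rw [(hd z).deriv]
    linarith [hm z]
  have hψ : ∀ z, HasDerivAt (fun z => G z + m / 2 * z ^ 2) (g z + m * z) z := fun z => by
    refine ((hG z).add (((hasDerivAt_id z).pow 2).const_mul (m / 2))).congr_deriv ?_
    simp
    ring
  have hcont : Continuous fun z => G z + m / 2 * z ^ 2 :=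
    continuous_iff_continuousAt.2 fun z => (hψ z).continuousAt
  have key : 0 ≤ G (a + h) + m / 2 * (a + h) ^ 2 - (G a + m / 2 * a ^ 2) - (g a + m * a) * h := by
    rcases lt_trichotomy h 0 with h0 | rfl | h0
    · obtain ⟨c, hc, hc'⟩ := exists_hasDerivAt_eq_slope _ _ (show a + h < a by linarith)
        hcont.continuousOn fun z _ => hψ z
      rw [eq_div_iff (by linarith)] at hc'
      have := hmono hc.2.le
      simp only at this
      nlinarith
    · simp
    · obtain ⟨c, hc, hc'⟩ := exists_hasDerivAt_eq_slope _ _ (show a < a + h by linarith)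
        hcont.continuousOn fun z _ => hψ z
      rw [eq_div_iff (by linarith)] at hc'
      have := hmono hc.1.le
      simp only at this
      nlinarith
  nlinarith

theorem abs_taylor_remainder_le {G g : ℝ → ℝ} {m : ℝ}
    (hG : ∀ z, HasDerivAt G (g z) z) (hg : Differentiable ℝ g) (hm : ∀ z, |deriv g z| ≤ m)
    (a h : ℝ) : |G (a + h) - G a - g a * h| ≤ m / 2 * h ^ 2 := by
  have h1 := neg_mul_sq_le_taylor_remainder hG hg (fun z => (abs_le.1 (hm z)).1) a h
  have h2 := neg_mul_sq_le_taylor_remainder (G := fun z => -G z) (g := fun z => -g z) (m := m)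
    (fun z => (hG z).neg) hg.neg (fun z => by
      rw [show (fun z => -g z) = -g from rfl, deriv.neg]
      linarith [(abs_le.1 (hm z)).2]) a h
  rw [abs_le]
  constructor <;> linarith

theorem abs_sub_le_of_abs_deriv_le {g : ℝ → ℝ} {m : ℝ} (hg : Differentiable ℝ g)
    (hm : ∀ z, |deriv g z| ≤ m) (a b : ℝ) : |g b - g a| ≤ m * |b - a| :=
  Convex.norm_image_sub_le_of_norm_deriv_le (fun z _ => hg z) (fun z _ => hm z) convex_univ
    (Set.mem_univ a) (Set.mem_univ b)

open Filter in
/-- Left Riemann sums of the derivative converge to the increment. -/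
theorem tendsto_riemann_sum {G g : ℝ → ℝ} {m : ℝ}
    (hG : ∀ z, HasDerivAt G (g z) z) (hg : Differentiable ℝ g) (hm : ∀ z, |deriv g z| ≤ m)
    (z : ℝ) :
    Tendsto (fun n : ℕ => ∑ k ∈ Finset.range (n + 1), g (k * (z / (n + 1))) * (z / (n + 1)))
      atTop (𝓝 (G z - G 0)) := by
  rw [tendsto_iff_norm_sub_tendsto_zero]
  refine squeeze_zero (g := fun n : ℕ => (m / 2 * z ^ 2) * (1 / ((n : ℝ) + 1)))
    (fun _ => norm_nonneg _) (fun n => ?_) ?_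
  · have hn : (0 : ℝ) < n + 1 := by positivity
    set h := z / ((n : ℝ) + 1) with hh
    -- Each of the `n + 1` cells contributes an error of at most `m/2 h²`, in total `m z² / (2 (n +
    -- 1))`.
    have tel : G z - G 0 = ∑ k ∈ Finset.range (n + 1), (G (k * h + h) - G (k * h)) := by
      have := Finset.sum_range_sub (fun k : ℕ => G (k * h)) (n + 1)
      simp only [Nat.cast_add, Nat.cast_one, Nat.cast_zero, zero_mul, add_mul, one_mul] at this
      rw [this]
      congr 2
      rw [hh]
      field_simp
    rw [norm_sub_rev, tel, ← Finset.sum_sub_distrib]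
    refine (norm_sum_le_of_le (f := fun k : ℕ => G (k * h + h) - G (k * h) - g (k * h) * h) _
      fun k _ => abs_taylor_remainder_le hG hg hm (k * h) h).trans (le_of_eq ?_)
    rw [Finset.sum_const, Finset.card_range, nsmul_eq_mul, hh]
    push_cast
    field_simp
  · have := (tendsto_one_div_add_atTop_nhds_zero_nat (𝕜 := ℝ)).const_mul (m / 2 * z ^ 2)
    rwa [mul_zero] at this

end Scalar

/-! ### Superposition operators on `L²` -/

section Superposition

variable {α : Type*} [MeasurableSpace α] {μ : Measure α}

/-- Superposition with a Carathéodory function preserves measurability. -/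
theorem aestronglyMeasurable_superposition {f : α → ℝ → ℝ} {w : α → ℝ}
    (hf : ∀ s, AEStronglyMeasurable (fun x => f x s) μ) (hc : ∀ᵐ x ∂μ, Continuous (f x))
    (hw : AEStronglyMeasurable w μ) : AEStronglyMeasurable (fun x => f x (w x)) μ := by
  obtain ⟨w', hw', hww'⟩ := hw
  suffices AEStronglyMeasurable (fun x => f x (w' x)) μ by
    refine this.congr ?_
    filter_upwards [hww'] with x hx
    rw [hx]
  refine aestronglyMeasurable_of_tendsto_ae Filter.atTop
    (f := fun n x => f x (hw'.approx n x)) (fun n => ?_) ?_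
  -- Along a simple function the superposition is a finite sum of indicators; continuity in the
  -- second variable then passes to the limit.
  · set s := hw'.approx n
    have : (fun x => f x (s x)) =
        fun x => ∑ y ∈ s.range, (s ⁻¹' {y}).indicator (fun x => f x y) x := by
      funext x
      rw [Finset.sum_eq_single (s x)]
      · simp
      · intro y _ hy
        exact Set.indicator_of_notMem (fun h => hy (by simpa using h.symm)) _
      · intro h
        exact absurd (s.mem_range_self x) h
    rw [this]
    exact Finset.aestronglyMeasurable_fun_sum _ fun y _ =>
      (hf y).indicator (s.measurableSet_fiber y)
  · filter_upwards [hc] with x hx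
    exact (hx.tendsto _).comp (hw'.tendsto_approx x)

/-- `f` is differentiable in the second variable with derivative bounded by `L`, square integrable
in the first one, and `F` is a primitive of `f` in the second variable. -/
structure IsLipschitzPotential (μ : Measure α) (f F : α → ℝ → ℝ) (L : ℝ) : Prop where
  memLp : ∀ s, MemLp (fun x => f x s) 2 μ
  differentiable : ∀ᵐ x ∂μ, Differentiable ℝ (f x)
  abs_deriv_le : ∀ᵐ x ∂μ, ∀ u, |deriv (f x) u| ≤ L
  hasDerivAt : ∀ᵐ x ∂μ, ∀ z, HasDerivAt (F x) (f x z) z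
  integrable_zero : Integrable (fun x => F x 0) μ

namespace IsLipschitzPotential

variable {f F : α → ℝ → ℝ} {L : ℝ}

/-- Linear growth: `|f(x, w)| ≤ |f(x, 0)| + L |w|`. -/
theorem memLp_superposition (h : IsLipschitzPotential μ f F L) {w : α → ℝ} (hw : MemLp w 2 μ) :
    MemLp (fun x => f x (w x)) 2 μ := by
  refine ((h.memLp 0).norm.add (hw.norm.const_mul L)).mono'
    (aestronglyMeasurable_superposition (fun s => (h.memLp s).1)
      (h.differentiable.mono fun x hx => hx.continuous) hw.1) ?_
  filter_upwards [h.differentiable, h.abs_deriv_le] with x h1 h2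
  have := abs_sub_le_of_abs_deriv_le h1 h2 0 (w x)
  rw [sub_zero] at this
  simp only [Pi.add_apply, Real.norm_eq_abs]
  linarith [abs_sub_abs_le_abs_sub (f x (w x)) (f x 0)]

/-- Measurability of `F` is assumed only at `z = 0`; the increment `F(x, z) - F(x, 0)` is a limit of
Riemann sums of the measurable functions `f(·, s)`. -/
theorem aestronglyMeasurable_potential (h : IsLipschitzPotential μ f F L) (z : ℝ) :
    AEStronglyMeasurable (fun x => F x z) μ := by
  suffices AEStronglyMeasurable (fun x => F x z - F x 0) μ from
    (this.add h.integrable_zero.1).congr (.of_forall fun x => sub_add_cancel _ _)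
  refine aestronglyMeasurable_of_tendsto_ae Filter.atTop
    (f := fun (n : ℕ) x =>
      ∑ k ∈ Finset.range (n + 1), f x (k * (z / (n + 1))) * (z / (n + 1))) (fun n => ?_) ?_
  · exact Finset.aestronglyMeasurable_fun_sum _ fun k _ => (h.memLp _).1.mul_const _
  · filter_upwards [h.differentiable, h.abs_deriv_le, h.hasDerivAt] with x h1 h2 h3
    exact tendsto_riemann_sum h3 h1 h2 z

theorem aestronglyMeasurable_potential_superposition (h : IsLipschitzPotential μ f F L)
    {w : α → ℝ} (hw : AEStronglyMeasurable w μ) :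
    AEStronglyMeasurable (fun x => F x (w x)) μ :=
  aestronglyMeasurable_superposition h.aestronglyMeasurable_potential
    (h.hasDerivAt.mono fun _ hx =>
      continuous_iff_continuousAt.2 fun z => (hx z).continuousAt) hw

/-- Taylor at `0` gives `|F(x, w) - F(x, 0)| ≤ |f(x, 0) w| + L/2 w²`. -/
theorem integrable_potential (h : IsLipschitzPotential μ f F L) {w : α → ℝ}
    (hw : MemLp w 2 μ) : Integrable (fun x => F x (w x)) μ := by
  suffices Integrable (fun x => F x (w x) - F x 0) μ from
    (this.add h.integrable_zero).congr (.of_forall fun x => sub_add_cancel _ _)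
  have hfw : Integrable (fun x => |f x 0 * w x|) μ := ((h.memLp 0).integrable_mul hw).abs
  refine (hfw.add (hw.integrable_sq.const_mul (L / 2))).mono'
    ((h.aestronglyMeasurable_potential_superposition hw.1).sub h.integrable_zero.1) ?_
  filter_upwards [h.differentiable, h.abs_deriv_le, h.hasDerivAt] with x h1 h2 h3
  have := abs_taylor_remainder_le h3 h1 h2 0 (w x)
  rw [zero_add] at this
  simp only [Pi.add_apply, Real.norm_eq_abs]
  linarith [abs_sub_abs_le_abs_sub (F x (w x) - F x 0) (f x 0 * w x)]

theorem integral_taylor_remainder (h : IsLipschitzPotential μ f F L) {w v : α → ℝ}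
    (hw : MemLp w 2 μ) (hv : MemLp v 2 μ) :
    ∫ x, (F x (w x + v x) - F x (w x) - f x (w x) * v x) ∂μ =
      ∫ x, F x (w x + v x) ∂μ - ∫ x, F x (w x) ∂μ - ∫ x, f x (w x) * v x ∂μ := by
  have i1 : Integrable (fun x => F x (w x + v x)) μ := h.integrable_potential (hw.add hv)
  have i2 := h.integrable_potential hw
  have i3 := (h.memLp_superposition hw).integrable_mul hv
  rw [← integral_sub i1 i2]
  exact integral_sub (i1.sub i2) i3

theorem integrable_taylor_remainder (h : IsLipschitzPotential μ f F L) {w v : α → ℝ}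
    (hw : MemLp w 2 μ) (hv : MemLp v 2 μ) :
    Integrable (fun x => F x (w x + v x) - F x (w x) - f x (w x) * v x) μ :=
  ((h.integrable_potential (hw.add hv)).sub (h.integrable_potential hw)).sub
    ((h.memLp_superposition hw).integrable_mul hv)

theorem abs_integral_taylor_remainder_le (h : IsLipschitzPotential μ f F L) {w v : α → ℝ}
    (hw : MemLp w 2 μ) (hv : MemLp v 2 μ) :
    |∫ x, F x (w x + v x) ∂μ - ∫ x, F x (w x) ∂μ - ∫ x, f x (w x) * v x ∂μ| ≤
      L / 2 * ∫ x, v x ^ 2 ∂μ := by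
  rw [← h.integral_taylor_remainder hw hv, ← integral_const_mul]
  refine norm_integral_le_of_norm_le (G := ℝ) (hv.integrable_sq.const_mul _) ?_
  filter_upwards [h.differentiable, h.abs_deriv_le, h.hasDerivAt] with x h1 h2 h3
  exact abs_taylor_remainder_le h3 h1 h2 _ _

theorem neg_le_integral_taylor_remainder (h : IsLipschitzPotential μ f F L) {m : ℝ}
    (hm : ∀ᵐ x ∂μ, ∀ u, -m ≤ deriv (f x) u) {w v : α → ℝ}
    (hw : MemLp w 2 μ) (hv : MemLp v 2 μ) :
    -(m / 2 * ∫ x, v x ^ 2 ∂μ) ≤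
      ∫ x, F x (w x + v x) ∂μ - ∫ x, F x (w x) ∂μ - ∫ x, f x (w x) * v x ∂μ := by
  rw [← h.integral_taylor_remainder hw hv, ← integral_const_mul, ← integral_neg]
  refine integral_mono_ae (hv.integrable_sq.const_mul _).neg
    (h.integrable_taylor_remainder hw hv) ?_
  filter_upwards [h.differentiable, hm, h.hasDerivAt] with x h1 h2 h3
  exact neg_mul_sq_le_taylor_remainder h3 h1 h2 _ _

end IsLipschitzPotential

theorem integral_superposition_add (F : α → ℝ → ℝ) (w v : Lp ℝ 2 μ) :
    ∫ x, F x ((w + v : Lp ℝ 2 μ) x) ∂μ = ∫ x, F x (w x + v x) ∂μ :=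
  integral_congr_ae ((Lp.coeFn_add w v).mono fun x hx => congrArg (F x) hx)

end Superposition

/-! ### Expansion and derivative of the energy, and the update equation -/

section Energy

variable {d : ℕ} {Ω : Set (EuclideanSpace ℝ (Fin d))}
  {f F : EuclideanSpace ℝ (Fin d) → ℝ → ℝ} {L : ℝ}

theorem integral_norm_sq_grad (v : H10 Ω) :
    ∫ x in Ω, ‖H10.grad v x‖ ^ 2 = ‖H10.grad v‖ ^ 2 := by
  rw [← real_inner_self_eq_norm_sq, L2.inner_def]
  exact integral_congr_ae (.of_forall fun x => (real_inner_self_eq_norm_sq _).symm)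

theorem integral_sq_val (v : H10 Ω) :
    ∫ x in Ω, (H10.val v x) ^ 2 = ‖H10.val v‖ ^ 2 := by
  rw [← real_inner_self_eq_norm_sq, L2.inner_def]
  exact integral_congr_ae (.of_forall fun x => by simp)

theorem linearization_eq_inner (η : ℝ) (u v : H10 Ω) :
    linearization Ω η u v =
      inner ℝ (H10.grad u) (H10.grad v) + η * inner ℝ (H10.val u) (H10.val v) := rfl

theorem norm_sq_eq (v : H10 Ω) : ‖v‖ ^ 2 = ‖H10.val v‖ ^ 2 + ‖H10.grad v‖ ^ 2 :=
  WithLp.prod_norm_sq_eq_of_L2 (v : L2Pair Ω)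

/-- The derivative `v ↦ ∫ ∇w · ∇v - ∫ f(x, w) v` of the energy. -/
noncomputable def energyDeriv (h : IsLipschitzPotential (volume.restrict Ω) f F L) (w : H10 Ω) :
    H10 Ω →L[ℝ] ℝ :=
  (innerSL ℝ (H10.grad w)).comp H10.grad -
    (innerSL ℝ ((h.memLp_superposition (Lp.memLp (H10.val w))).toLp _)).comp H10.val

theorem energyDeriv_apply (h : IsLipschitzPotential (volume.restrict Ω) f F L) (w v : H10 Ω) :
    energyDeriv h w v = inner ℝ (H10.grad w) (H10.grad v) -
      ∫ x in Ω, f x (H10.val w x) * H10.val v x := by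
  change inner ℝ (H10.grad w) (H10.grad v) - inner ℝ _ (H10.val v) = _
  congr 1
  rw [L2.inner_def]
  refine integral_congr_ae ?_
  filter_upwards [(h.memLp_superposition (Lp.memLp (H10.val w))).coeFn_toLp] with x hx
  rw [hx]
  exact mul_comm _ _

theorem energy_eq (v : H10 Ω) :
    energy Ω F v = 1 / 2 * ‖H10.grad v‖ ^ 2 - ∫ x in Ω, F x (H10.val v x) := by
  rw [energy, integral_norm_sq_grad]

theorem energy_sub_of_eq_add (h : IsLipschitzPotential (volume.restrict Ω) f F L) {u w v : H10 Ω}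
    (hval : H10.val u = H10.val w + H10.val v) (hgrad : H10.grad u = H10.grad w + H10.grad v) :
    energy Ω F u - energy Ω F w =
      energyDeriv h w v + 1 / 2 * ‖H10.grad v‖ ^ 2 -
        ((∫ x in Ω, F x (H10.val w x + H10.val v x)) - (∫ x in Ω, F x (H10.val w x)) -
          ∫ x in Ω, f x (H10.val w x) * H10.val v x) := by
  have arith : ∀ {Eu Ew D a b c i₁ i₂ i₃ : ℝ}, Eu = 1 / 2 * (a ^ 2 + 2 * c + b ^ 2) - i₁ →
      Ew = 1 / 2 * a ^ 2 - i₂ → D = c - i₃ →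
      Eu - Ew = D + 1 / 2 * b ^ 2 - (i₁ - i₂ - i₃) := by
    intros
    linarith
  have e := integral_superposition_add (μ := volume.restrict Ω) F (H10.val w) (H10.val v)
  have hn := norm_add_sq_real (H10.grad w) (H10.grad v)
  have hu := energy_eq (F := F) u
  have hw := energy_eq (F := F) w
  have hd := energyDeriv_apply h w v
  rw [hval, hgrad, e, hn] at hu
  exact arith hu hw hd

theorem energy_add_sub (h : IsLipschitzPotential (volume.restrict Ω) f F L) (w v : H10 Ω) :
    energy Ω F (w + v) - energy Ω F w =
      energyDeriv h w v + 1 / 2 * ‖H10.grad v‖ ^ 2 -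
        ((∫ x in Ω, F x (H10.val w x + H10.val v x)) - (∫ x in Ω, F x (H10.val w x)) -
          ∫ x in Ω, f x (H10.val w x) * H10.val v x) :=
  energy_sub_of_eq_add h rfl rfl

theorem abs_energy_taylor_remainder_le (h : IsLipschitzPotential (volume.restrict Ω) f F L)
    (w v : H10 Ω) : |energy Ω F (w + v) - energy Ω F w - energyDeriv h w v| ≤
      1 / 2 * ‖H10.grad v‖ ^ 2 + L / 2 * ‖H10.val v‖ ^ 2 := by
  have h1 := h.abs_integral_taylor_remainder_le (Lp.memLp (H10.val w)) (Lp.memLp (H10.val v))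
  rw [integral_sq_val, abs_le] at h1
  have h2 := energy_add_sub h w v
  have h3 := sq_nonneg ‖H10.grad v‖
  rw [abs_le]
  constructor <;> linarith [h1.1, h1.2]

theorem abs_energy_taylor_remainder_smul_le
    (h : IsLipschitzPotential (volume.restrict Ω) f F L) (w v : H10 Ω) (t : ℝ) :
    |energy Ω F (w + t • v) - energy Ω F w - t * energyDeriv h w v| ≤
      t ^ 2 * (1 / 2 * ‖H10.grad v‖ ^ 2 + L / 2 * ‖H10.val v‖ ^ 2) := by
  have hval : ‖H10.val (t • v)‖ ^ 2 = t ^ 2 * ‖H10.val v‖ ^ 2 :=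
    (congrArg (· ^ 2) (norm_smul t (H10.val v))).trans (by
      simp only [mul_pow, Real.norm_eq_abs, sq_abs])
  have hgrad : ‖H10.grad (t • v)‖ ^ 2 = t ^ 2 * ‖H10.grad v‖ ^ 2 :=
    (congrArg (· ^ 2) (norm_smul t (H10.grad v))).trans (by
      simp only [mul_pow, Real.norm_eq_abs, sq_abs])
  have hE : energyDeriv h w (t • v) = t * energyDeriv h w v := (energyDeriv h w).map_smul t v
  have h1 := abs_energy_taylor_remainder_le h w (t • v)
  rw [hE, hval, hgrad] at h1
  refine h1.trans (le_of_eq ?_)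
  ring

/-- Only the lower bound on `∂f/∂u` enters the upper bound on the energy, so `m` may be smaller than
`L`. -/
theorem energy_add_sub_le (h : IsLipschitzPotential (volume.restrict Ω) f F L) {m : ℝ}
    (hm : ∀ᵐ x ∂(volume.restrict Ω), ∀ u, -m ≤ deriv (f x) u) (w v : H10 Ω) :
    energy Ω F (w + v) - energy Ω F w ≤
      energyDeriv h w v + 1 / 2 * ‖H10.grad v‖ ^ 2 + m / 2 * ‖H10.val v‖ ^ 2 := by
  have h1 := h.neg_le_integral_taylor_remainder hm (Lp.memLp (H10.val w)) (Lp.memLp (H10.val v))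
  rw [integral_sq_val] at h1
  linarith [energy_add_sub h w v]

theorem hasGateauxDerivAt_energy (h : IsLipschitzPotential (volume.restrict Ω) f F L)
    (w : H10 Ω) : HasGateauxDerivAt (energy Ω F) (energyDeriv h w) w := by
  intro v
  set C := 1 / 2 * ‖H10.grad v‖ ^ 2 + L / 2 * ‖H10.val v‖ ^ 2
  rw [tendsto_iff_norm_sub_tendsto_zero]
  -- The remainder is at most `t² C`, so the difference quotient errs by at most `|t| C`.
  refine squeeze_zero' (g := fun t : ℝ => |t| * C) (.of_forall fun _ => norm_nonneg _) ?_ ?_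
  · filter_upwards [self_mem_nhdsWithin] with t ht
    have ht : t ≠ 0 := ht
    have h1 := abs_energy_taylor_remainder_smul_le h w v t
    have h2 : (energy Ω F (w + t • v) - energy Ω F w) / t - energyDeriv h w v =
        (energy Ω F (w + t • v) - energy Ω F w - t * energyDeriv h w v) / t := by
      field_simp
    rw [h2, Real.norm_eq_abs, abs_div, div_le_iff₀ (abs_pos.2 ht)]
    refine h1.trans (le_of_eq ?_)
    rw [mul_right_comm, abs_mul_abs_self, sq]
  · have : Filter.Tendsto (fun t : ℝ => |t| * C) (𝓝 0) (𝓝 (|0| * C)) :=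
      (continuous_abs.mul continuous_const).tendsto 0
    rw [abs_zero, zero_mul] at this
    exact this.mono_left nhdsWithin_le_nhds

theorem HasGateauxDerivAt.unique {X : Type*} [NormedAddCommGroup X] [NormedSpace ℝ X]
    {E : X → ℝ} {L₁ L₂ : X →L[ℝ] ℝ} {u : X} (h₁ : HasGateauxDerivAt E L₁ u)
    (h₂ : HasGateauxDerivAt E L₂ u) : L₁ = L₂ :=
  ContinuousLinearMap.ext fun v => tendsto_nhds_unique (h₁ v) (h₂ v)

theorem isCoercive_linearization {η : ℝ} (hη : 0 < η) : IsCoercive (linearization Ω η) := by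
  refine ⟨min 1 η, lt_min one_pos hη, fun v => ?_⟩
  rw [linearization_eq_inner, real_inner_self_eq_norm_sq, real_inner_self_eq_norm_sq, mul_assoc,
    ← sq, norm_sq_eq]
  nlinarith [mul_le_mul_of_nonneg_right (min_le_left 1 η) (sq_nonneg ‖H10.grad v‖),
    mul_le_mul_of_nonneg_right (min_le_right 1 η) (sq_nonneg ‖H10.val v‖)]

/-- Solvability of the update equation, by the Lax-Milgram theorem. -/
theorem exists_isUpdateAt {η : ℝ} (hη : 0 < η) (E' : H10 Ω → (H10 Ω →L[ℝ] ℝ)) :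
    ∃ T : H10 Ω → H10 Ω, ∀ w, IsUpdateAt E' (fun _ => linearization Ω η) T w := by
  have hc := isCoercive_linearization (Ω := Ω) hη
  refine ⟨fun w => w + hc.continuousLinearEquivOfBilin.symm
    ((InnerProductSpace.toDual ℝ (H10 Ω)).symm (-E' w)), fun w v => ?_⟩
  rw [add_sub_cancel_left, ← hc.continuousLinearEquivOfBilin_apply,
    ContinuousLinearEquiv.apply_symm_apply, InnerProductSpace.toDual_symm_apply]
  rfl

end Energy

/-! ### The constants `μ_f`, `κ_f`, `γ_f` and the energy decay -/

section Constants

variable {d : ℕ} {Ω : Set (EuclideanSpace ℝ (Fin d))} {f : EuclideanSpace ℝ (Fin d) → ℝ → ℝ}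
  {ρ : ℝ}

/-- Unfolds `|∂f/∂u + 1/t| < ρ + 1/t`, an interval centred at `-1/t`. -/
theorem ae_deriv_mem_of_mem_Lambda {t : ℝ} (ht : t ∈ Lambda Ω f ρ) :
    ∀ᵐ x ∂(volume.restrict Ω), ∀ u, -(ρ + 2 / t) ≤ deriv (f x) u ∧ deriv (f x) u ≤ ρ := by
  filter_upwards [ae_lt_of_essSup_lt ht.2] with x hx u
  have h1 := (le_iSup (fun u => ENNReal.ofReal |deriv (f x) u + 1 / t|) u).trans_lt hx
  have h2 := abs_lt.1 (lt_of_not_ge fun h => h1.not_ge (ENNReal.ofReal_le_ofReal h))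
  have h3 : 2 / t = 1 / t + 1 / t := by ring
  constructor <;> linarith [h2.1, h2.2]

/-- `μ_f` is the infimum of `2 / t` over `Λ_f(ρ)`. -/
theorem exists_mem_Lambda_lt (hne : (Lambda Ω f ρ).Nonempty) {ε : ℝ} (hε : 0 < ε) :
    ∃ t ∈ Lambda Ω f ρ, 2 / t < mu Ω f ρ + ε := by
  obtain ⟨t₀, ht₀⟩ := hne
  unfold mu
  split_ifs with hb
  · set S := sSup (Lambda Ω f ρ)
    have hS : 0 < S := ht₀.1.trans_le (le_csSup hb ht₀)
    have hS' : 2 / (2 * S⁻¹ + ε) < S := by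
      rw [div_lt_iff₀ (by positivity)]
      have : S * (2 * S⁻¹ + ε) = 2 + S * ε := by field_simp
      rw [this]
      linarith [mul_pos hS hε]
    obtain ⟨t, ht, hlt⟩ := exists_lt_of_lt_csSup ⟨t₀, ht₀⟩ hS'
    exact ⟨t, ht, (div_lt_comm₀ (by positivity) ht.1).1 hlt⟩
  · obtain ⟨t, ht, hlt⟩ := not_bddAbove_iff.1 hb (2 / ε)
    exact ⟨t, ht, by rw [zero_add]; exact (div_lt_comm₀ hε ht.1).1 hlt⟩

theorem kappa_nonneg (CP : ℝ) : 0 ≤ kappa Ω f ρ CP :=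
  mul_nonneg (by norm_num) (le_max_left _ _)

theorem gammaf_div {CP η : ℝ} (hη : 0 < η) :
    gammaf Ω f ρ CP η / η = min ((η - kappa Ω f ρ CP) / (η + CP⁻¹)) (1 / 2) :=
  mul_div_cancel_left₀ _ hη.ne'

/-- The choice of `γ_f` balances gradient and mass terms by Poincaré's inequality. -/
theorem gammaf_div_mul_le {CP η a b : ℝ} (hCP : 0 < CP) (hη : 0 < η) (hb : 0 ≤ b)
    (hab : b ≤ CP * a) :
    gammaf Ω f ρ CP η / η * (a + η * b) ≤ 1 / 2 * a + (η - (mu Ω f ρ + ρ) / 2) * b := by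
  rw [gammaf_div hη]
  set γ := min ((η - kappa Ω f ρ CP) / (η + CP⁻¹)) (1 / 2)
  have hC : 0 < CP⁻¹ := inv_pos.2 hCP
  have h1 : γ * (η + CP⁻¹) ≤ η - kappa Ω f ρ CP :=
    (le_div_iff₀ (by positivity)).1 (min_le_left _ _)
  have h2 : γ ≤ 1 / 2 := min_le_right _ _
  have h3 : mu Ω f ρ + ρ - CP⁻¹ ≤ 2 * kappa Ω f ρ CP := by
    rw [kappa]
    linarith [le_max_right 0 (mu Ω f ρ + ρ - CP⁻¹)]
  have h4 : CP⁻¹ * b ≤ a := by rwa [inv_mul_le_iff₀ hCP]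
  -- Since `γ ≤ 1/2`, the gradient surplus `(1/2 - γ) a` is nonnegative and pays for `(1/2 - γ)
  -- C_P⁻¹ b`.
  have h5 := mul_le_mul_of_nonneg_left h4 (sub_nonneg.2 h2)
  have h6 := mul_le_mul_of_nonneg_right h1 hb
  have h7 := mul_le_mul_of_nonneg_right h3 hb
  linarith

/-- The energy decay along an update step. -/
theorem gammaf_div_mul_linearization_le {F : EuclideanSpace ℝ (Fin d) → ℝ → ℝ} {L CP η : ℝ}
    (h : IsLipschitzPotential (volume.restrict Ω) f F L) (hne : (Lambda Ω f ρ).Nonempty)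
    (hCP0 : 0 < CP)
    (hCP : ∀ v : H10 Ω, (∫ x in Ω, (H10.val v x) ^ 2) ≤ CP * (∫ x in Ω, ‖H10.grad v x‖ ^ 2))
    (hη : 0 < η) {w δ : H10 Ω} (hδ : linearization Ω η δ δ = -energyDeriv h w δ) :
    gammaf Ω f ρ CP η / η * linearization Ω η δ δ ≤ energy Ω F w - energy Ω F (w + δ) := by
  have hA : linearization Ω η δ δ = ‖H10.grad δ‖ ^ 2 + η * ‖H10.val δ‖ ^ 2 := by
    rw [linearization_eq_inner, real_inner_self_eq_norm_sq, real_inner_self_eq_norm_sq]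
  have hP := hCP δ
  rw [integral_sq_val, integral_norm_sq_grad] at hP
  have hmain := gammaf_div_mul_le (Ω := Ω) (f := f) (ρ := ρ) hCP0 hη (sq_nonneg _) hP
  rw [← hA] at hmain
  -- The infimum `μ_f` need not be attained. Choosing `t` within `ε / (b + 1)` of it costs at most
  -- `ε`; the `+ 1` covers `b = 0`.
  refine hmain.trans (le_of_forall_pos_le_add fun ε hε => ?_)
  have hb : 0 < ‖H10.val δ‖ ^ 2 + 1 := by positivity
  obtain ⟨t, ht, hlt⟩ := exists_mem_Lambda_lt hne (div_pos hε hb)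
  have h1 := energy_add_sub_le h
    ((ae_deriv_mem_of_mem_Lambda ht).mono fun x hx u => (hx u).1) w δ
  have h2 := mul_le_mul_of_nonneg_right hlt.le (sq_nonneg ‖H10.val δ‖)
  have h3 : ε / (‖H10.val δ‖ ^ 2 + 1) * ‖H10.val δ‖ ^ 2 ≤ ε := by
    rw [div_mul_eq_mul_div, div_le_iff₀ hb]
    linarith
  linarith

end Constants

end Semilinear

/-! ### The main theorem -/

open Semilinear in
theorem mainTheorem8 {d : ℕ} (Ω : Set (EuclideanSpace ℝ (Fin d)))
    (hΩo : IsOpen Ω) (hΩb : Bornology.IsBounded Ω)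
    -- the reaction term, with conditions (i)-(iii)
    (f : EuclideanSpace ℝ (Fin d) → ℝ → ℝ)
    (hf_i : ∀ s : ℝ, MemLp (fun x => f x s) 2 (volume.restrict Ω))
    (hf_ii : ∀ x ∈ Ω, Differentiable ℝ (f x))
    (ρ : ℝ) (hρ : 0 < ρ) (hf_iii : (Lambda Ω f ρ).Nonempty)
    -- a potential of the reaction term
    (F : EuclideanSpace ℝ (Fin d) → ℝ → ℝ)
    (hF : ∀ᵐ x ∂(volume.restrict Ω), ∀ z : ℝ, HasDerivAt (F x) (f x z) z)
    (hF0 : IntegrableOn (fun x => F x 0) Ω)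
    -- a Poincaré constant of the domain
    (CP : ℝ) (hCP0 : 0 < CP)
    (hCP : ∀ v : H10 Ω, (∫ x in Ω, (H10.val v x) ^ 2) ≤ CP * (∫ x in Ω, ‖H10.grad v x‖ ^ 2))
    (η : ℝ) (hη : kappa Ω f ρ CP < η) :
    (∃ (E' : H10 Ω → (H10 Ω →L[ℝ] ℝ)) (T : H10 Ω → H10 Ω),
      (∀ w, HasGateauxDerivAt (energy Ω F) (E' w) w) ∧
      (∀ w, IsUpdateAt E' (fun _ => linearization Ω η) T w)) ∧
    ∀ (u₀ : H10 Ω) (E' : H10 Ω → (H10 Ω →L[ℝ] ℝ)) (T : H10 Ω → H10 Ω),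
      (∀ w ∈ levelSet (energy Ω F) u₀, HasGateauxDerivAt (energy Ω F) (E' w) w) →
      (∀ w ∈ levelSet (energy Ω F) u₀, IsUpdateAt E' (fun _ => linearization Ω η) T w) →
      PropertyT (energy Ω F) E' (fun _ => linearization Ω η) T u₀
        (gammaf Ω f ρ CP η / η) := by
  have hη0 : 0 < η := (kappa_nonneg CP).trans_lt hη
  obtain ⟨t₀, ht₀⟩ := hf_iii
  -- Any element of `Λ_f(ρ)` provides a Lipschitz constant; its size does not affect `γ`.
  have h : IsLipschitzPotential (volume.restrict Ω) f F (ρ + 2 / t₀) := by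
    refine ⟨hf_i, (ae_restrict_mem hΩo.measurableSet).mono hf_ii, ?_, hF, hF0⟩
    filter_upwards [ae_deriv_mem_of_mem_Lambda ht₀] with x hx u
    have : 0 < 2 / t₀ := div_pos two_pos ht₀.1
    exact abs_le.2 ⟨(hx u).1, by linarith [(hx u).2]⟩
  refine ⟨?_, fun u₀ E' T hE hT => ⟨?_, fun w hw => ?_⟩⟩
  · obtain ⟨T, hT⟩ := exists_isUpdateAt hη0 (energyDeriv h)
    exact ⟨energyDeriv h, T, hasGateauxDerivAt_energy h, hT⟩
  · rw [gammaf_div hη0]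
    exact lt_min (div_pos (sub_pos.2 hη) (by positivity)) one_half_pos
  · have hupd := hT w hw (T w - w)
    have hE' := (hE w hw).unique (hasGateauxDerivAt_energy h w)
    have hsec := gammaf_div_mul_linearization_le h ⟨t₀, ht₀⟩ hCP0 hCP hη0
      (w := w) (δ := T w - w) (hE' ▸ hupd)
    have hTw : energy Ω F (w + (T w - w)) = energy Ω F (T w) :=
      congrArg (energy Ω F) (add_sub_cancel w (T w))
    replace hsec := hsec.trans_eq (congrArg (energy Ω F w - ·) hTw)
    -- By the update equation at `v = T w - w`, both forms of property (T) are the same inequality.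
    exact ⟨by rw [neg_mul, ← mul_neg, ← hupd]; exact hsec, hsec⟩
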